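/- Fix an integer $n\ge 2$, and let $\hat S=\langle v,w,\sigma\rangle$ be a group of order $2^{2n+2}$, where $\hat A=\langle v,w\rangle\cong C_{2^n}\times C_{2^n}$ is normal in $\hat S$, $\hat S=\hat A\rtimes\langle\sigma\rangle$ (that is, $\hat S=\hat A\langle\sigma\rangle$ and $\hat A\cap\langle\sigma\rangle=1$), $\sigma^4=1$, $\sigma^{-1}v\sigma=w$ and $\sigma^{-1}w\sigma=v^{-1}$. Then $\hat A$ is normal in every saturated fusion system $\mathcal F$ over $\hat S$; that is, each morphism of $\mathcal F$ extends to a morphism of $\mathcal F$ that is defined on $\hat A$ and sends $\hat A$ onto itself. Here a fusion system $\mathcal F$ over a finite $p$-group $S$ is a category whose objects are the subgroups of $S$, whose morphism sets $\mathrm{Hom}_{\mathcal F}(P,Q)$ consist of injective homomorphisms and contain all conjugations $c_g\colon x\mapsto gxg^{-1}$ with $g\in S$, $gPg^{-1}\le Q$, and in which every morphism is an $\mathcal F$-isomorphism followed by an inclusion. Subgroups $P,Q$ are $\mathcal F$-conjugate if they are isomorphic in $\mathcal F$; $P$ is fully normalized (fully centralized) if $|N_S(P)|\ge|N_S(Q)|$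 (respectively $|C_S(P)|\ge|C_S(Q)|$) for each $Q$ that is $\mathcal F$-conjugate to $P$. Write $\mathrm{Aut}_{\mathcal F}(P)$ for the group of $\mathcal F$-automorphisms of $P$, and $\mathrm{Aut}_S(P)$ for the group of automorphisms of $P$ induced by conjugation by elements of $N_S(P)$. The fusion system $\mathcal F$ is saturated if (i) each fully normalized $P\le S$ is fully centralized, and $\mathrm{Aut}_S(P)$ is a Sylow $p$-subgroup of $\mathrm{Aut}_{\mathcal F}(P)$; and (ii) each $\mathcal F$-isomorphism $\varphi\colon P\to Q$ with $Q$ fully centralized extends to a morphism $\overline\varphi\in\mathrm{Hom}_{\mathcal F}(N_\varphi,S)$, where $N_\varphi=\{g\in N_S(P)\mid \varphi c_g\varphi^{-1}\in\mathrm{Aut}_S(Q)\}$. -/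

import Mathlib

/-- The conjugation homomorphism `c_g : P → Q`, `x ↦ g x g⁻¹`, for `g` with `g P g⁻¹ ≤ Q`. -/
def conjHom {S : Type*} [Group S] (g : S) (P Q : Subgroup S)
    (h : ∀ x ∈ P, g * x * g⁻¹ ∈ Q) : P →* Q where
  toFun x := ⟨g * (x : S) * g⁻¹, h x x.2⟩
  map_one' := by ext; simp
  map_mul' x y := by ext; simp [mul_assoc]

/-- A fusion system over a group `S` (used for finite `p`-groups `S`): a category whose objects are
the subgroups of `S` and whose morphisms `P → Q` are injective homomorphisms, among them all
those induced by conjugation in `S`, such that every morphism is the composite of an isomorphism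
of the category followed by an inclusion. Identities and inclusions are conjugations by `1`. -/
structure FusionSystem (S : Type*) [Group S] where
  /-- The set of morphisms from `P` to `Q`. -/
  Hom : ∀ P Q : Subgroup S, Set (P →* Q)
  injective : ∀ {P Q : Subgroup S} {φ : P →* Q}, φ ∈ Hom P Q → Function.Injective φ
  comp_mem : ∀ {P Q R : Subgroup S} {φ : P →* Q} {ψ : Q →* R},
    φ ∈ Hom P Q → ψ ∈ Hom Q R → ψ.comp φ ∈ Hom P R
  conj_mem : ∀ (g : S) (P Q : Subgroup S) (h : ∀ x ∈ P, g * x * g⁻¹ ∈ Q),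
    conjHom g P Q h ∈ Hom P Q
  factor : ∀ {P Q : Subgroup S} {φ : P →* Q}, φ ∈ Hom P Q →
    ∃ (R : Subgroup S) (hR : R ≤ Q) (e : P ≃* R),
      e.toMonoidHom ∈ Hom P R ∧ e.symm.toMonoidHom ∈ Hom R P ∧
      φ = (Subgroup.inclusion hR).comp e.toMonoidHom

namespace FusionSystem

/-- `ψ : P' → Q'` extends `φ : P → Q`: `P ≤ P'`, `Q ≤ Q'`, and `ψ` agrees with `φ` on `P`. -/
def Extends {S : Type*} [Group S] {P Q P' Q' : Subgroup S} (ψ : P' →* Q') (φ : P →* Q) : Prop :=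
  ∃ h : P ≤ P', Q ≤ Q' ∧ ∀ x : P, ((ψ (Subgroup.inclusion h x) : Q') : S) = (φ x : S)

/-- `Aut_S(P)`: the automorphisms of `P` induced by conjugation by elements of `N_S(P)`. -/
def autS {S : Type*} [Group S] (P : Subgroup S) : Subgroup (MulAut P) :=
  P.normalizerMonoidHom.range

/-- The set of isomorphisms from `P` to `Q` in the category `F`. -/
def Iso {S : Type*} [Group S] (F : FusionSystem S) (P Q : Subgroup S) : Set (P ≃* Q) :=
  {e | e.toMonoidHom ∈ F.Hom P Q ∧ e.symm.toMonoidHom ∈ F.Hom Q P}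

/-- `Aut_F(P)`, as a subgroup of the automorphism group of `P`. -/
def aut {S : Type*} [Group S] (F : FusionSystem S) (P : Subgroup S) : Subgroup (MulAut P) where
  carrier := F.Iso P P
  mul_mem' {a b} ha hb := ⟨F.comp_mem hb.1 ha.1, F.comp_mem ha.2 hb.2⟩
  one_mem' := by
    have h : conjHom 1 P P (by simp) = MonoidHom.id P := by ext; simp [conjHom]
    have := F.conj_mem 1 P P (by simp)
    rw [h] at this
    exact ⟨this, this⟩
  inv_mem' {a} ha := ⟨ha.2, ha.1⟩

/-- `P` and `Q` are `F`-conjugate. -/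
def IsConj {S : Type*} [Group S] (F : FusionSystem S) (P Q : Subgroup S) : Prop :=
  (F.Iso P Q).Nonempty

/-- `P` is fully normalized in `F`. -/
def FullyNormalized {S : Type*} [Group S] (F : FusionSystem S) (P : Subgroup S) : Prop :=
  ∀ Q : Subgroup S, F.IsConj P Q →
    Nat.card (Subgroup.normalizer (Q : Set S)) ≤ Nat.card (Subgroup.normalizer (P : Set S))

/-- `P` is fully centralized in `F`. -/
def FullyCentralized {S : Type*} [Group S] (F : FusionSystem S) (P : Subgroup S) : Prop :=
  ∀ Q : Subgroup S, F.IsConj P Q →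
    Nat.card (Subgroup.centralizer (Q : Set S)) ≤ Nat.card (Subgroup.centralizer (P : Set S))

/-- `N_φ = {g ∈ N_S(P) | φ c_g φ⁻¹ ∈ Aut_S(Q)}`, as a subgroup of `S`. -/
def extDomain {S : Type*} [Group S] {P Q : Subgroup S} (φ : P ≃* Q) : Subgroup S :=
  ((autS Q).comap ((MulAut.congr φ).toMonoidHom.comp P.normalizerMonoidHom)).map
    (Subgroup.normalizer (P : Set S)).subtype

/-- Saturation of a fusion system over a finite `p`-group: the Sylow axiom and the
extension axiom. -/
structure IsSaturated {S : Type*} [Group S] (p : ℕ) (F : FusionSystem S) : Prop where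
  sylow : ∀ P : Subgroup S, F.FullyNormalized P →
    F.FullyCentralized P ∧
    ∃ T : Sylow p (F.aut P), (T : Subgroup (F.aut P)) = (autS P).subgroupOf (F.aut P)
  extension : ∀ (P Q : Subgroup S) (φ : P ≃* Q), φ ∈ F.Iso P Q → F.FullyCentralized Q →
    ∃ ψ ∈ F.Hom (extDomain φ) ⊤, Extends ψ φ.toMonoidHom

/-- `P` is normal in `F`: each morphism of `F` extends to a morphism of `F` that is defined on `P`
and sends `P` onto itself. -/
def IsNormal {S : Type*} [Group S] (F : FusionSystem S) (P : Subgroup S) : Prop :=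
  ∀ (Q R : Subgroup S) (φ : Q →* R), φ ∈ F.Hom Q R →
    ∃ (Q' R' : Subgroup S) (ψ : Q' →* R'), ψ ∈ F.Hom Q' R' ∧ Extends ψ φ ∧ P ≤ Q' ∧
      ((P.subgroupOf Q').map ψ).map R'.subtype = P

end FusionSystem

/-! The quotient S/A is cyclic of order 4, and elements of its nontrivial square class invert A. Two
facts combine.

First, an abelian normal subgroup A that is strongly closed is normal in F
(`isNormal_of_stronglyClosed`). Elements of N_A(P) act on P trivially on P ∩ A and modulo it. Such
automorphisms form a p-group, and isomorphisms of F preserve their kind. So when R is fully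
normalized, those lying in Aut_F(R) are all induced by S, and the extension axiom carries P → R up
to P·N_A(P), and by induction to PA.

Second, A is strongly closed (`QuarterTurn.stronglyClosed`). Fourth powers lie in A, and an element
outside A with square in A is an involution, so it suffices that no involution x outside A is
conjugate into A. Such an x lies in the frame T = Ω₁(A)⟨x⟩, elementary abelian of order 8. If
Aut_F(T), with T fully normalized, moved T ∩ A, Sylow conjugation would put into Aut_S(T) a
transvection with axis other than T ∩ A. Extending a second transvection with that axis then sends a
commutator of S outside A, although S/A is abelian (`IsFrame.not_mem_autS`). The assumption n ≥ 2
makes every involution of A a square in A, which is what produces transvections. -/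

namespace FusionSystem

/-! ### Generalities on fusion systems and saturation -/

section Basic

variable {S : Type*} [Group S] {F : FusionSystem S}

theorem Iso.trans_mem {P Q R : Subgroup S} {e : P ≃* Q} {f : Q ≃* R} (he : e ∈ F.Iso P Q)
    (hf : f ∈ F.Iso Q R) : e.trans f ∈ F.Iso P R :=
  ⟨F.comp_mem he.1 hf.1, F.comp_mem hf.2 he.2⟩

theorem Iso.symm_mem {P Q : Subgroup S} {e : P ≃* Q} (he : e ∈ F.Iso P Q) :
    e.symm ∈ F.Iso Q P :=
  ⟨he.2, he.1⟩

theorem inclusion_mem (F : FusionSystem S) {P Q : Subgroup S} (h : P ≤ Q) :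
    Subgroup.inclusion h ∈ F.Hom P Q := by
  have h1 := F.conj_mem 1 P Q (by simpa using fun x hx => h hx)
  convert h1
  ext
  simp [conjHom]

theorem exists_iso_of_mem {P Q : Subgroup S} {φ : P →* Q} (hφ : φ ∈ F.Hom P Q) :
    ∃ R ≤ Q, ∃ e ∈ F.Iso P R, ∀ x, (e x : S) = φ x := by
  obtain ⟨R, hR, e, h1, h2, rfl⟩ := F.factor hφ
  exact ⟨R, hR, e, ⟨h1, h2⟩, fun x => rfl⟩

theorem exists_iso_restrict {P Q P' : Subgroup S} {φ : P →* Q} (hφ : φ ∈ F.Hom P Q)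
    (h : P' ≤ P) :
    ∃ R ≤ Q, ∃ e ∈ F.Iso P' R, ∀ x, (e x : S) = φ (Subgroup.inclusion h x) :=
  exists_iso_of_mem (F.comp_mem (F.inclusion_mem h) hφ)

theorem isConj_refl (F : FusionSystem S) (P : Subgroup S) : F.IsConj P P :=
  ⟨MulEquiv.refl P, (F.aut P).one_mem⟩

theorem mem_autS {P : Subgroup S} {γ : MulAut P} :
    γ ∈ autS P ↔ ∃ g ∈ Subgroup.normalizer (P : Set S), ∀ t : P, (γ t : S) = g * t * g⁻¹ := by
  constructor
  · rintro ⟨g, rfl⟩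
    exact ⟨g, g.2, fun t => rfl⟩
  · rintro ⟨g, hg, h⟩
    refine ⟨⟨g, hg⟩, ?_⟩
    ext t
    rw [h]
    rfl

theorem autS_le_aut (F : FusionSystem S) (P : Subgroup S) : autS P ≤ F.aut P := by
  have key : ∀ γ ∈ autS P, γ.toMonoidHom ∈ F.Hom P P := by
    intro γ hγ
    obtain ⟨g, hg, h⟩ := mem_autS.1 hγ
    have := F.conj_mem g P P (fun x hx => (Subgroup.mem_normalizer_iff.1 hg x).1 hx)
    convert this
    ext t
    exact h t
  exact fun γ hγ => ⟨key γ hγ, key γ⁻¹ (inv_mem hγ)⟩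

theorem mem_extDomain {P Q : Subgroup S} {φ : P ≃* Q} {g : S} {γ : MulAut P}
    (hg : g ∈ Subgroup.normalizer (P : Set S)) (hγ : ∀ t : P, (γ t : S) = g * t * g⁻¹)
    (h : MulAut.congr φ γ ∈ autS Q) : g ∈ extDomain φ := by
  refine ⟨⟨g, hg⟩, ?_, rfl⟩
  have : P.normalizerMonoidHom ⟨g, hg⟩ = γ := by
    ext t
    rw [hγ]
    rfl
  simpa [this] using h

theorem congr_mem_aut {P Q : Subgroup S} {φ : P ≃* Q} (hφ : φ ∈ F.Iso P Q) {γ : MulAut P}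
    (hγ : γ ∈ F.aut P) : MulAut.congr φ γ ∈ F.aut Q :=
  (Iso.trans_mem (Iso.symm_mem hφ) (Iso.trans_mem hγ hφ) : φ.symm.trans (γ.trans φ) ∈ F.Iso Q Q)

/-- Isomorphisms onto fully centralized subgroups send commutators of elements of the extension
domain to commutators of `S`. -/
theorem exists_commutator_eq {p : ℕ} (hF : F.IsSaturated p) {P Q : Subgroup S} {φ : P ≃* Q}
    (hφ : φ ∈ F.Iso P Q) (hQ : F.FullyCentralized Q) {g h : S} (hg : g ∈ extDomain φ)
    (hh : h ∈ extDomain φ) {t : P} (ht : (t : S) = g * h * g⁻¹ * h⁻¹) :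
    ∃ g' h' : S, (φ t : S) = g' * h' * g'⁻¹ * h'⁻¹ := by
  obtain ⟨ψ, -, hP, -, hψ⟩ := hF.extension P Q φ hφ hQ
  refine ⟨ψ ⟨g, hg⟩, ψ ⟨h, hh⟩, ?_⟩
  have h1 := hψ t
  have h2 : Subgroup.inclusion hP t = ⟨g, hg⟩ * ⟨h, hh⟩ * ⟨g, hg⟩⁻¹ * ⟨h, hh⟩⁻¹ :=
    Subtype.ext ht
  rw [h2, map_mul, map_mul, map_mul, map_inv, map_inv] at h1
  exact h1.symm

variable [Finite S]

theorem exists_fullyNormalized (F : FusionSystem S) (P : Subgroup S) :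
    ∃ Q, F.FullyNormalized Q ∧ ∃ e : P ≃* Q, e ∈ F.Iso P Q := by
  obtain ⟨Q, ⟨e, he⟩, hQ⟩ := Set.Finite.exists_maximalFor
    (fun Q : Subgroup S => Nat.card (Subgroup.normalizer (Q : Set S))) {Q | F.IsConj P Q}
    (Set.toFinite _) ⟨P, F.isConj_refl P⟩
  refine ⟨Q, ?_, e, he⟩
  rintro R ⟨f, hf⟩
  by_contra! h
  exact absurd (hQ ⟨_, Iso.trans_mem he hf⟩ h.le) h.not_ge

theorem exists_fullyCentralized (F : FusionSystem S) (P : Subgroup S) :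
    ∃ Q, F.FullyCentralized Q ∧ ∃ e : P ≃* Q, e ∈ F.Iso P Q := by
  obtain ⟨Q, ⟨e, he⟩, hQ⟩ := Set.Finite.exists_maximalFor
    (fun Q : Subgroup S => Nat.card (Subgroup.centralizer (Q : Set S))) {Q | F.IsConj P Q}
    (Set.toFinite _) ⟨P, F.isConj_refl P⟩
  refine ⟨Q, ?_, e, he⟩
  rintro R ⟨f, hf⟩
  by_contra! h
  exact absurd (hQ ⟨_, Iso.trans_mem he hf⟩ h.le) h.not_ge

/-- A `p`-group of automorphisms of a fully normalized subgroup can be conjugated into the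
automorphisms induced by `S`. -/
theorem exists_conj_mem_autS {p : ℕ} [Fact p.Prime] (hF : F.IsSaturated p) {T : Subgroup S}
    (hT : F.FullyNormalized T) {H : Subgroup (MulAut T)} (hH : IsPGroup p H) :
    ∃ β ∈ F.aut T, ∀ h ∈ H, h ∈ F.aut T → β * h * β⁻¹ ∈ autS T := by
  obtain ⟨-, P, hP⟩ := hF.sylow T hT
  have : Finite (MulAut T) := Finite.of_injective (fun e : MulAut T => (e : T → T))
    DFunLike.coe_injective
  have h1 : IsPGroup p (H.subgroupOf (F.aut T)) :=
    hH.comap_of_injective _ (Subgroup.subtype_injective _)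
  obtain ⟨Q, hQ⟩ := h1.exists_le_sylow
  obtain ⟨β, hβ⟩ := MulAction.exists_smul_eq (F.aut T) Q P
  refine ⟨β, β.2, fun h hh hhF => ?_⟩
  have h2 : (⟨h, hhF⟩ : F.aut T) ∈ Q := hQ hh
  have h3 : β * ⟨h, hhF⟩ * β⁻¹ ∈ P := by
    rw [← hβ]
    exact Subgroup.smul_mem_pointwise_smul _ (MulAut.conj β) _ h2
  have h4 : β * ⟨h, hhF⟩ * β⁻¹ ∈ (P : Subgroup (F.aut T)) := h3
  rw [hP] at h4
  exact h4

end Basic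

end FusionSystem

namespace FusionSystem

/-! ### Abelian strongly closed subgroups are normal in the fusion system -/

section StronglyClosed

variable {S : Type*} [Group S] {F : FusionSystem S} {A : Subgroup S}

/-- `A` is strongly closed: no morphism sends an element of `A` outside `A`. -/
def StronglyClosed (F : FusionSystem S) (A : Subgroup S) : Prop :=
  ∀ (P Q : Subgroup S) (φ : P →* Q), φ ∈ F.Hom P Q → ∀ x : P, (x : S) ∈ A → (φ x : S) ∈ A

/-- The automorphisms of `P` that are trivial on `P ∩ A` and modulo `P ∩ A`. -/
def seriesStabilizer (A P : Subgroup S) : Subgroup (MulAut P) where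
  carrier := {γ | (∀ x : P, ((γ x * x⁻¹ : P) : S) ∈ A) ∧ ∀ x : P, (x : S) ∈ A → γ x = x}
  one_mem' := ⟨fun x => by simp, fun x _ => rfl⟩
  mul_mem' {a b} ha hb := by
    refine ⟨fun x => ?_, fun x hx => ?_⟩
    · have h1 : (a * b) x * x⁻¹ = (a (b x) * (b x)⁻¹) * (b x * x⁻¹) := by simp
      rw [h1]
      exact A.mul_mem (ha.1 _) (hb.1 _)
    · rw [MulAut.mul_apply, hb.2 x hx, ha.2 x hx]
  inv_mem' {a} ha := by
    refine ⟨fun x => ?_, fun x hx => ?_⟩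
    · have h1 := A.inv_mem (ha.1 (a⁻¹ x))
      rw [MulAut.apply_inv_self] at h1
      simpa using h1
    · have h1 := MulAut.inv_apply_self P a x
      rwa [ha.2 x hx] at h1

/-- Since γ fixes γ(x)x⁻¹, which lies in A, its powers satisfy γ^m(x) = (γ(x)x⁻¹)^m x; take m = |S|.
-/
theorem isPGroup_seriesStabilizer {p : ℕ} (hS : IsPGroup p S) [Finite S] [Fact p.Prime]
    (P : Subgroup S) : IsPGroup p (seriesStabilizer A P) := by
  obtain ⟨k, hk⟩ := (IsPGroup.iff_card.1 hS)
  rintro ⟨γ, hγ⟩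
  refine ⟨k, Subtype.ext ?_⟩
  have key : ∀ (m : ℕ) (x : P), (γ ^ m) x = (γ x * x⁻¹) ^ m * x := by
    intro m x
    induction m with
    | zero => simp
    | succ m ih =>
      rw [pow_succ', MulAut.mul_apply, ih, map_mul,
        hγ.2 _ (by simpa using A.pow_mem (hγ.1 x) m), pow_succ]
      group
  ext x
  change ((γ ^ p ^ k) x : S) = x
  rw [key, ← hk]
  simp

theorem congr_mem_seriesStabilizer (hA : F.StronglyClosed A) {P R : Subgroup S} {φ : P ≃* R}
    (hφ : φ ∈ F.Iso P R) {γ : MulAut P} (hγ : γ ∈ seriesStabilizer A P) :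
    MulAut.congr φ γ ∈ seriesStabilizer A R := by
  refine ⟨fun x => ?_, fun x hx => ?_⟩
  · have h1 : MulAut.congr φ γ x * x⁻¹ = φ (γ (φ.symm x) * (φ.symm x)⁻¹) := by
      simp
    rw [h1]
    exact hA _ _ _ hφ.1 _ (hγ.1 _)
  · have h1 : (φ.symm x : S) ∈ A := hA _ _ _ hφ.2 _ hx
    change φ (γ (φ.symm x)) = x
    rw [hγ.2 _ h1, MulEquiv.apply_symm_apply]

theorem le_extDomain {p : ℕ} (hF : F.IsSaturated p) {P Q : Subgroup S} {φ : P ≃* Q}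
    (hφ : φ ∈ F.Iso P Q) (hQ : F.FullyCentralized Q) : P ≤ extDomain φ := by
  obtain ⟨ψ, -, hP, -⟩ := hF.extension P Q φ hφ hQ
  exact hP

variable [Finite S] {p : ℕ} [Fact p.Prime]

/-- N_A(P) stabilizes the series of P because A is abelian and normal. Transported by φ, it lands in
the stabilizer for R, whose intersection with Aut_F(R) is a normal p-subgroup, hence inside the
Sylow subgroup Aut_S(R). -/
theorem inf_normalizer_le_extDomain (hS : IsPGroup p S) (hF : F.IsSaturated p) [A.Normal]
    (hcomm : ∀ a ∈ A, ∀ b ∈ A, a * b = b * a) (hA : F.StronglyClosed A) {P R : Subgroup S}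
    {φ : P ≃* R} (hφ : φ ∈ F.Iso P R) (hR : F.FullyNormalized R) :
    A ⊓ Subgroup.normalizer (P : Set S) ≤ extDomain φ := by
  rintro g ⟨hgA, hgP⟩
  set γ : MulAut P := P.normalizerMonoidHom ⟨g, hgP⟩ with hγ
  have hγS : γ ∈ autS P := ⟨_, rfl⟩
  have hγ1 : γ ∈ seriesStabilizer A P := by
    refine ⟨fun x => ?_, fun x hx => Subtype.ext ?_⟩
    · change g * x * g⁻¹ * (x : S)⁻¹ ∈ A
      have h1 := A.mul_mem hgA (Subgroup.Normal.conj_mem ‹_› _ (A.inv_mem hgA) (x : S))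
      simpa [mul_assoc] using h1
    · change g * x * g⁻¹ = x
      rw [hcomm g hgA x hx, mul_inv_cancel_right]
  refine mem_extDomain hgP (γ := γ) (fun t => rfl) ?_
  obtain ⟨β, hβ, h⟩ := exists_conj_mem_autS hF hR (isPGroup_seriesStabilizer (A := A) hS R)
  have h2 := congr_mem_seriesStabilizer hA hφ hγ1
  have h3 := congr_mem_aut hφ (F.autS_le_aut P hγS)
  -- Conjugating by β⁻¹ first stays in the stabilizer, so conjugating back by β puts the original
  -- automorphism in Aut_S(R).
  have hβ' : β⁻¹ ∈ F.Iso R R := (F.aut R).inv_mem hβ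
  have h4 := congr_mem_seriesStabilizer hA hβ' h2
  have h5 := congr_mem_aut hβ' h3
  have h6 := h _ h4 h5
  have h7 : MulAut.congr β⁻¹ (MulAut.congr φ γ) = β⁻¹ * MulAut.congr φ γ * β := rfl
  rw [h7] at h6
  simpa [mul_assoc] using h6

/-- A strongly closed subgroup of `P` is contained in every subgroup isomorphic to `P` in `F`. -/
theorem le_of_mem_iso (hA : F.StronglyClosed A) {P R : Subgroup S} {φ : P ≃* R}
    (hφ : φ ∈ F.Iso P R) (h : A ≤ P) : A ≤ R := by
  have h1 : ∀ a : A, (φ ⟨a, h a.2⟩ : S) ∈ A := fun a => hA _ _ _ hφ.1 _ a.2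
  have h2 : Function.Injective (fun a : A => (⟨_, h1 a⟩ : A)) := by
    intro a b hab
    simpa [← Subtype.ext_iff] using hab
  intro a ha
  obtain ⟨b, hb⟩ := Finite.surjective_of_injective h2 ⟨a, ha⟩
  rw [← show _ = a from congrArg Subtype.val hb]
  exact (φ _).2

open scoped Pointwise in
/-- The codomain of an extension of `φ : P ≃ R` to `P A` is `R A`. -/
theorem eq_sup_of_extends [A.Normal] (hA : F.StronglyClosed A) {P R R' : Subgroup S}
    {φ : P ≃* R} {ψ : (P ⊔ A : Subgroup S) ≃* R'} (hψ : ψ ∈ F.Iso (P ⊔ A) R')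
    (h : ∀ x : P, (ψ ⟨x, Subgroup.mem_sup_left x.2⟩ : S) = φ x) : R' = R ⊔ A := by
  have hA' : A ≤ R' := le_of_mem_iso hA hψ le_sup_right
  apply le_antisymm
  · intro y hy
    obtain ⟨⟨x, hx⟩, hxy⟩ := ψ.surjective ⟨y, hy⟩
    have hx' : x ∈ (P : Set S) * (A : Set S) := by
      rw [← Subgroup.mul_normal]
      exact hx
    obtain ⟨u, hu, a, ha, rfl⟩ := hx'
    have h1 : (⟨u * a, hx⟩ : (P ⊔ A : Subgroup S)) =
      ⟨u, Subgroup.mem_sup_left hu⟩ * ⟨a, Subgroup.mem_sup_right ha⟩ := rfl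
    rw [← show _ = y from Subtype.ext_iff.1 hxy, h1, map_mul]
    refine Subgroup.mul_mem_sup ?_ (hA _ _ _ hψ.1 _ ha)
    rw [h ⟨u, hu⟩]
    exact (φ _).2
  · refine sup_le (fun y hy => ?_) hA'
    obtain ⟨x, hx⟩ := φ.surjective ⟨y, hy⟩
    rw [← show _ = y from Subtype.ext_iff.1 hx, ← h]
    exact (ψ _).2

-- Normalizers grow in the nilpotent group PA, and if ua normalizes P with u in P, then so does a.
open scoped Pointwise in
theorem lt_sup_inf_normalizer (hS : IsPGroup p S) [A.Normal] {P : Subgroup S} (h : ¬ A ≤ P) :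
    P < P ⊔ A ⊓ Subgroup.normalizer (P : Set S) := by
  have : Group.IsNilpotent (P ⊔ A : Subgroup S) := (hS.to_subgroup _).isNilpotent
  have h1 : P.subgroupOf (P ⊔ A) < ⊤ := by
    rw [lt_top_iff_ne_top, Ne, Subgroup.subgroupOf_eq_top]
    exact fun h2 => h (le_sup_right.trans h2)
  obtain ⟨g, hg, hgP⟩ :=
    SetLike.exists_of_lt (Group.normalizerCondition_of_isNilpotent _ h1)
  have hx' : (g : S) ∈ (P : Set S) * (A : Set S) := by
    rw [← Subgroup.mul_normal]
    exact g.2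
  obtain ⟨u, hu, a, ha, hua⟩ := hx'
  have hua : u * a = g := hua
  have hgN : (g : S) ∈ Subgroup.normalizer (P : Set S) := by
    rw [Subgroup.mem_normalizer_iff] at hg ⊢
    have key : ∀ k : (P ⊔ A : Subgroup S), ((k : S) ∈ P ↔ (g : S) * k * (g : S)⁻¹ ∈ P) := hg
    intro k
    constructor
    · exact fun hk => (key ⟨k, Subgroup.mem_sup_left hk⟩).1 hk
    · intro hk
      have h2 : (g : S)⁻¹ * (g * k * (g : S)⁻¹) * g ∈ P ⊔ A :=
        mul_mem (mul_mem (inv_mem g.2) (Subgroup.mem_sup_left hk)) g.2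
      have h3 : (g : S)⁻¹ * (g * k * (g : S)⁻¹) * g = k := by group
      rw [h3] at h2
      exact (key ⟨k, h2⟩).2 hk
  have haN : a ∈ Subgroup.normalizer (P : Set S) := by
    rw [eq_inv_mul_of_mul_eq hua]
    exact mul_mem (inv_mem (Subgroup.le_normalizer hu)) hgN
  refine lt_of_le_of_ne le_sup_left fun h2 => hgP ?_
  have h3 : a ∈ P := by
    rw [h2]
    exact Subgroup.mem_sup_right ⟨ha, haN⟩
  rw [Subgroup.mem_subgroupOf, ← hua]
  exact mul_mem hu h3

/-- Morphisms of `F` between subgroups extend to the products with `A`. -/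
theorem exists_extends_sup (hS : IsPGroup p S) (hF : F.IsSaturated p) [A.Normal]
    (hcomm : ∀ a ∈ A, ∀ b ∈ A, a * b = b * a) (hA : F.StronglyClosed A) (P : Subgroup S) :
    ∀ (R : Subgroup S) (φ : P ≃* R), φ ∈ F.Iso P R →
      ∃ (R' : Subgroup S) (ψ : (P ⊔ A : Subgroup S) ≃* R'),
        ψ ∈ F.Iso (P ⊔ A) R' ∧ ∀ x : P, (ψ ⟨x, Subgroup.mem_sup_left x.2⟩ : S) = φ x := by
  induction h : Nat.card S - Nat.card P using Nat.strong_induction_on generalizing P with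
  | _ m ih =>
  intro R φ hφ
  by_cases hAP : A ≤ P
  · obtain ⟨R', -, e, he, h⟩ := exists_iso_restrict hφ.1 (sup_le le_rfl hAP)
    exact ⟨R', e, he, fun x => h _⟩
  -- Fully normalized target: extend to the strictly larger P·N_A(P), apply induction there, and
  -- restrict to PA.
  have step : ∀ (P T : Subgroup S) (θ : P ≃* T), θ ∈ F.Iso P T → F.FullyNormalized T →
      Nat.card S - Nat.card P = m → ¬ A ≤ P →
      ∃ (R' : Subgroup S) (ψ : (P ⊔ A : Subgroup S) ≃* R'),
        ψ ∈ F.Iso (P ⊔ A) R' ∧ ∀ x : P, (ψ ⟨x, Subgroup.mem_sup_left x.2⟩ : S) = θ x := by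
    intro P T θ hθ hT hm hAP
    have hTc := (hF.sylow T hT).1
    have hlt := lt_sup_inf_normalizer hS hAP
    obtain ⟨ψ, hψ, h1, -, h2⟩ := hF.extension P T θ hθ hTc
    obtain ⟨R₁, -, e, he, h3⟩ := exists_iso_restrict hψ
      (sup_le h1 (inf_normalizer_le_extDomain hS hF hcomm hA hθ hT))
    have hcard : Nat.card P < Nat.card (P ⊔ A ⊓ Subgroup.normalizer (P : Set S) : Subgroup S) :=
      Set.Finite.card_lt_card (Set.toFinite _) hlt
    have hcard' := Subgroup.card_le_card_group (P ⊔ A ⊓ Subgroup.normalizer (P : Set S))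
    obtain ⟨R₂, f, hf, h4⟩ := ih _ (by omega) _ rfl R₁ e he
    obtain ⟨R₃, -, k, hk, h5⟩ := exists_iso_restrict hf.1
      (sup_le_sup_right le_sup_left A : P ⊔ A ≤ _)
    refine ⟨R₃, k, hk, fun x => ?_⟩
    rw [h5]
    exact ((h4 ⟨x, Subgroup.mem_sup_left x.2⟩).trans (h3 _)).trans (h2 x)
  -- For an arbitrary target R, extend both P → T and R → T to maps onto TA and compose one with the
  -- inverse of the other.
  obtain ⟨T, hT, χ, hχ⟩ := F.exists_fullyNormalized R
  have hAR : ¬ A ≤ R := fun h1 => hAP (le_of_mem_iso hA (Iso.symm_mem hφ) h1)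
  obtain ⟨R₁, ψ₁, hψ₁, h₁⟩ := step P T _ (Iso.trans_mem hφ hχ) hT h hAP
  obtain ⟨R₂, ψ₂, hψ₂, h₂⟩ := step R T χ hχ hT (by rw [← h, Nat.card_congr φ.toEquiv]) hAR
  obtain rfl := eq_sup_of_extends hA hψ₁ h₁
  obtain rfl := eq_sup_of_extends hA hψ₂ h₂
  refine ⟨_, ψ₁.trans ψ₂.symm, Iso.trans_mem hψ₁ (Iso.symm_mem hψ₂), fun x => ?_⟩
  have h3 : ψ₁ ⟨x, Subgroup.mem_sup_left x.2⟩ = ψ₂ ⟨φ x, Subgroup.mem_sup_left (φ x).2⟩ :=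
    Subtype.ext ((h₁ x).trans (h₂ (φ x)).symm)
  rw [MulEquiv.trans_apply, h3, MulEquiv.symm_apply_apply]

/-- An abelian strongly closed subgroup of a saturated fusion system is normal in it. -/
theorem isNormal_of_stronglyClosed (hS : IsPGroup p S) (hF : F.IsSaturated p) [A.Normal]
    (hcomm : ∀ a ∈ A, ∀ b ∈ A, a * b = b * a) (hA : F.StronglyClosed A) : F.IsNormal A := by
  intro Q R φ hφ
  obtain ⟨R₀, hR₀, e, he, h⟩ := exists_iso_of_mem hφ
  obtain ⟨R', ψ, hψ, h1⟩ := exists_extends_sup hS hF hcomm hA Q R₀ e he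
  obtain rfl := eq_sup_of_extends hA hψ h1
  have hle : R₀ ⊔ A ≤ R ⊔ A := sup_le_sup_right hR₀ A
  refine ⟨Q ⊔ A, R ⊔ A, (Subgroup.inclusion hle).comp ψ.toMonoidHom,
    F.comp_mem hψ.1 (F.inclusion_mem hle), ⟨le_sup_left, le_sup_left, fun x => ?_⟩,
    le_sup_right, ?_⟩
  · exact (h1 x).trans (h x)
  · ext a
    constructor
    · rintro ⟨_, ⟨x, hx, rfl⟩, rfl⟩
      exact hA _ _ _ hψ.1 x hx
    · intro ha
      have h2 : (ψ.symm ⟨a, Subgroup.mem_sup_right ha⟩ : S) ∈ A := hA _ _ _ hψ.2 _ ha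
      refine ⟨_, ⟨_, h2, rfl⟩, ?_⟩
      simp

end StronglyClosed

end FusionSystem

namespace FusionSystem

/-! ### Frames and their transvections -/

section QuarterTurn

variable {S : Type*} [Group S]

/-- The properties of an abelian normal subgroup `A` with cyclic quotient of order `4`, on which
a generator of the quotient acts as a square root of inversion. -/
structure QuarterTurn (A : Subgroup S) : Prop where
  normal : A.Normal
  comm : ∀ a ∈ A, ∀ b ∈ A, a * b = b * a
  commutator_mem : ∀ g h : S, g * h * g⁻¹ * h⁻¹ ∈ A
  fourth_mem : ∀ g : S, g * g * (g * g) ∈ A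
  sq_eq_one : ∀ g : S, g ∉ A → g * g ∈ A → g * g = 1
  conj_eq_inv : ∀ g : S, g ∉ A → g * g ∈ A → ∀ a ∈ A, g * a * g⁻¹ = a⁻¹
  mul_mem : ∀ g h : S, g ∉ A → g * g ∈ A → h ∉ A → h * h ∈ A → g * h ∈ A
  sq_mul_mem : ∀ g h : S, g * g ∉ A → h * h ∉ A → g * h * (g * h) ∈ A
  exists_sqrt : ∀ v ∈ A, v * v = 1 → ∃ b ∈ A, b * b = v
  exists_pair : ∃ a ∈ A, ∃ b ∈ A, a * a = 1 ∧ b * b = 1 ∧ a ≠ 1 ∧ b ≠ 1 ∧ a ≠ b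

/-- An elementary abelian `2`-subgroup containing all involutions of `A` but not contained
in `A`. -/
structure IsFrame (A T : Subgroup S) : Prop where
  sq : ∀ t ∈ T, t * t = 1
  mem : ∀ v ∈ A, v * v = 1 → v ∈ T
  exists_notMem : ∃ x ∈ T, x ∉ A

variable {A T E : Subgroup S}

namespace IsFrame

theorem mul_self (hT : IsFrame A T) (t : T) : t * t = 1 :=
  Subtype.ext (hT.sq t t.2)

theorem inv_eq (hT : IsFrame A T) (t : T) : t⁻¹ = t :=
  inv_eq_of_mul_eq_one_left (hT.mul_self t)

theorem mul_comm (hT : IsFrame A T) (s t : T) : s * t = t * s := by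
  rw [← hT.inv_eq (s * t), mul_inv_rev, hT.inv_eq, hT.inv_eq]

theorem mul_mul_self (hT : IsFrame A T) (s t : T) : s * (s * t) = t := by
  rw [← mul_assoc, hT.mul_self, one_mul]

theorem mul_mem_of_notMem (hT : IsFrame A T) (hA : QuarterTurn A) {s t : T} (hs : (s : S) ∉ A)
    (ht : (t : S) ∉ A) : (s : S) * t ∈ A :=
  hA.mul_mem s t hs (by rw [hT.sq s s.2]; exact A.one_mem) ht
    (by rw [hT.sq t t.2]; exact A.one_mem)

/-- A cuts a frame in index two. If φ mapped E ∩ A and one further element into A, it would map all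
of E into A, but T is not in A. -/
theorem mem_of_apply_mem (hA : QuarterTurn A) (hE : IsFrame A E) (hT : IsFrame A T)
    {φ : E ≃* T} (h : ∀ t : E, (t : S) ∈ A → (φ t : S) ∈ A) {t : E} (ht : (φ t : S) ∈ A) :
    (t : S) ∈ A := by
  by_contra h1
  obtain ⟨x, hx, hxA⟩ := hT.exists_notMem
  obtain ⟨s, hs⟩ := φ.surjective ⟨x, hx⟩
  have hx' : (φ s : S) ∉ A := by rwa [hs]
  by_cases hsA : (s : S) ∈ A
  · exact hx' (h s hsA)
  · have h2 := h (s * t) (hE.mul_mem_of_notMem hA hsA h1)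
    rw [map_mul] at h2
    exact hx' ((A.mul_mem_cancel_right ht).1 h2)

/-- Squares in `A` of order two give transvections of a frame. -/
theorem exists_conj (hT : IsFrame A T) (hA : QuarterTurn A) {b : S} {l : T} (hb : b ∈ A)
    (hl : b * b = l) : b ∈ Subgroup.normalizer (T : Set S) ∧ ∃ κ ∈ autS T,
      (∀ t : T, (κ t : S) = b * t * b⁻¹) ∧
      (∀ t : T, (t : S) ∈ A → κ t = t) ∧ ∀ t : T, (t : S) ∉ A → κ t = l * t := by
  have h1 : ∀ t ∈ T, t ∈ A → b * t * b⁻¹ = t := fun t _ htA => by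
    rw [hA.comm b hb t htA, mul_inv_cancel_right]
  have h2 : ∀ t ∈ T, t ∉ A → b * t * b⁻¹ = l * t := fun t ht htA => by
    have h3 := hA.conj_eq_inv t htA (by rw [hT.sq t ht]; exact A.one_mem) b⁻¹ (A.inv_mem hb)
    rw [inv_inv] at h3
    calc b * t * b⁻¹ = b * (t * b⁻¹ * t⁻¹) * t := by group
      _ = l * t := by rw [h3, hl]
  have h3 : ∀ t ∈ T, b * t * b⁻¹ ∈ T := fun t ht => by
    by_cases htA : t ∈ A
    · rwa [h1 t ht htA]
    · rw [h2 t ht htA]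
      exact T.mul_mem l.2 ht
  have hn : b ∈ Subgroup.normalizer (T : Set S) := by
    rw [Subgroup.mem_normalizer_iff]
    refine fun t => ⟨h3 t, fun ht => ?_⟩
    have h4 := h3 _ ht
    have h5 : b * (b * t * b⁻¹) * b⁻¹ = l * t * (l : S)⁻¹ := by rw [← hl]; group
    rw [h5] at h4
    exact (T.mul_mem_cancel_left l.2).1 ((T.mul_mem_cancel_right (T.inv_mem l.2)).1 h4)
  exact ⟨hn, T.normalizerMonoidHom ⟨b, hn⟩, ⟨_, rfl⟩, fun t => rfl,
    fun t ht => Subtype.ext (h1 t t.2 ht), fun t ht => Subtype.ext (h2 t t.2 ht)⟩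

end IsFrame

/-- The automorphisms that are trivial modulo the subgroup `{1, l}`. -/
def lineStabilizer (l : T) (hl : l * l = 1) : Subgroup (MulAut T) where
  carrier := {γ | γ l = l ∧ ∀ t, γ t = t ∨ γ t = l * t}
  one_mem' := ⟨rfl, fun t => Or.inl rfl⟩
  mul_mem' {a b} ha hb := by
    refine ⟨by rw [MulAut.mul_apply, hb.1, ha.1], fun t => ?_⟩
    rw [MulAut.mul_apply]
    rcases hb.2 t with h | h <;> rcases ha.2 t with h' | h' <;>
      simp [h, h', ha.1, ← mul_assoc, hl]
  inv_mem' {a} ha := by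
    have key : ∀ s t, a s = t → a⁻¹ t = s := by
      rintro s _ rfl
      exact MulAut.inv_apply_self T a s
    refine ⟨key _ _ ha.1, fun t => ?_⟩
    rcases ha.2 t with h | h
    · exact Or.inl (key _ _ h)
    · refine Or.inr (key _ _ ?_)
      rw [map_mul, ha.1, h, ← mul_assoc, hl, one_mul]

theorem isPGroup_lineStabilizer (l : T) (hl : l * l = 1) :
    IsPGroup 2 (lineStabilizer l hl) := by
  rintro ⟨γ, h1, h2⟩
  refine ⟨1, Subtype.ext (MulEquiv.ext fun t => ?_)⟩
  change (γ ^ 2 ^ 1) t = t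
  rw [pow_one, pow_two, MulAut.mul_apply]
  rcases h2 t with h | h
  · rw [h, h]
  · rw [h, map_mul, h1, h, ← mul_assoc, hl, one_mul]

variable {F : FusionSystem S}

/-- A square root of α⁻¹(l) in A induces a transvection with axis T ∩ A; its conjugate by α has axis
α(T ∩ A) and center l. -/
theorem IsFrame.exists_transvection (hT : IsFrame A T) (hA : QuarterTurn A) {α : MulAut T}
    (hα : α ∈ F.aut T) {l : T} (hl : (α⁻¹ l : S) ∈ A) :
    ∃ k ∈ F.aut T, (∀ t : T, (α⁻¹ t : S) ∈ A → k t = t) ∧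
      ∀ t : T, (α⁻¹ t : S) ∉ A → k t = l * t := by
  obtain ⟨b, hb, hbl⟩ := hA.exists_sqrt _ hl (hT.sq _ (α⁻¹ l).2)
  obtain ⟨-, κ, hκ, -, h1, h2⟩ := hT.exists_conj hA hb hbl
  refine ⟨α * κ * α⁻¹, mul_mem (mul_mem hα (F.autS_le_aut T hκ)) (inv_mem hα), fun t ht => ?_,
    fun t ht => ?_⟩
  · rw [MulAut.mul_apply, MulAut.mul_apply, h1 _ ht, MulAut.apply_inv_self]
  · rw [MulAut.mul_apply, MulAut.mul_apply, h2 _ ht, map_mul, MulAut.apply_inv_self,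
      MulAut.apply_inv_self]

/-- Write V = α(T ∩ A), the axis of k, and suppose that g induces k. Then l lies in A and g
generates S modulo A. For b in A with b² = l, the commutator u = [g, b] is an involution of A
outside V. The transvection γ with axis V and center m in V but not in A has both g and b in its
extension domain, so γ(u) = mu is a commutator of S outside A, a contradiction. -/
theorem IsFrame.not_mem_autS (hF : F.IsSaturated 2) (hT : IsFrame A T) (hA : QuarterTurn A)
    (hTn : F.FullyNormalized T) {α : MulAut T} (hα : α ∈ F.aut T) {t₀ : T} (ht₀ : (t₀ : S) ∈ A)
    (hαt₀ : (α t₀ : S) ∉ A) {l : T} (hl1 : l ≠ 1) (hl : (α⁻¹ l : S) ∈ A) {k : MulAut T}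
    (h1 : ∀ t : T, (α⁻¹ t : S) ∈ A → k t = t) (h2 : ∀ t : T, (α⁻¹ t : S) ∉ A → k t = l * t) :
    k ∉ autS T := by
  intro hk
  have hAn := hA.normal
  obtain ⟨g, hgN, hg⟩ := mem_autS.1 hk
  have hmovel : ∀ t, (α⁻¹ t : S) ∉ A → k t ≠ t := fun t ht h => by
    rw [h2 t ht] at h
    exact hl1 (mul_eq_right.1 h)
  obtain ⟨t₁, ht₁, hαt₁⟩ : ∃ t : T, (t : S) ∈ A ∧ (α⁻¹ t : S) ∉ A := by
    by_contra! h
    exact hαt₀ (hT.mem_of_apply_mem hA hT h (φ := α⁻¹) (by rwa [MulAut.inv_apply_self]))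
  have hlA : (l : S) ∈ A := by
    have h3 : (k t₁ : S) ∈ A := by
      rw [hg]
      exact hAn.conj_mem _ ht₁ g
    rw [h2 _ hαt₁] at h3
    exact (A.mul_mem_cancel_right ht₁).1 h3
  -- An element with square in A centralizes the involutions of A, whereas g moves t₁.
  have hg2 : g * g ∉ A := by
    intro h3
    refine hmovel t₁ hαt₁ (Subtype.ext ?_)
    rw [hg]
    by_cases hgA : g ∈ A
    · rw [hA.comm g hgA _ ht₁, mul_inv_cancel_right]
    · rw [hA.conj_eq_inv g hgA h3 _ ht₁]
      exact inv_eq_of_mul_eq_one_left (hT.sq _ t₁.2)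
  obtain ⟨b, hb, hbl⟩ := hA.exists_sqrt _ hlA (hT.sq _ l.2)
  obtain ⟨hbN, κ, hκ, hκb, hκ1, hκ2⟩ := hT.exists_conj hA hb hbl
  set c := g * b * g⁻¹ with hc
  have hcA : c ∈ A := hAn.conj_mem _ hb g
  have hcc : c * c = l := by
    have h3 := hg l
    rw [h1 l hl] at h3
    rw [h3, ← hbl, hc]
    group
  have hgc : g * c * g⁻¹ = b⁻¹ := by
    rw [← hA.conj_eq_inv (g * g) hg2 (hA.fourth_mem g) b hb, hc]
    group
  have hll : (l : S) * l = 1 := hT.sq _ l.2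
  have hbc := hA.comm b hb c hcA
  have hu2 : (c * b⁻¹) * (c * b⁻¹) = 1 := by
    have h3 : c * b⁻¹ * (c * b⁻¹) = c * c * (b * b)⁻¹ := by
      have h4 : Commute c b⁻¹ := (show Commute c b from hbc.symm).inv_right
      rw [mul_inv_rev]
      calc c * b⁻¹ * (c * b⁻¹) = c * (b⁻¹ * c) * b⁻¹ := by group
        _ = c * (c * b⁻¹) * b⁻¹ := by rw [h4.eq]
        _ = _ := by group
    rw [h3, hcc, hbl, mul_inv_cancel]
  have huA : c * b⁻¹ ∈ A := A.mul_mem hcA (A.inv_mem hb)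
  set u : T := ⟨c * b⁻¹, hT.mem _ huA hu2⟩ with hu
  have hku : k u = l * u := by
    apply Subtype.ext
    rw [hg]
    have h3 : g * (u : S) * g⁻¹ = b⁻¹ * c⁻¹ := by
      calc g * (c * b⁻¹) * g⁻¹ = (g * c * g⁻¹) * (g * b * g⁻¹)⁻¹ := by group
        _ = _ := by rw [hgc]
    have h4 : ((l * u : T) : S) = b * c := by
      change (l : S) * (c * b⁻¹) = b * c
      rw [← hbl]
      calc b * b * (c * b⁻¹) = b * (b * c) * b⁻¹ := by group
        _ = b * (c * b) * b⁻¹ := by rw [hbc]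
        _ = b * c := by group
    have h5 : (b * c) * (b * c) = 1 := by
      calc (b * c) * (b * c) = b * (c * b) * c := by group
        _ = (b * b) * (c * c) := by rw [← hbc]; group
        _ = 1 := by rw [hbl, hcc, hll]
    rw [h3, h4, ← mul_inv_rev, ← hbc]
    exact inv_eq_of_mul_eq_one_left h5
  have huV : (α⁻¹ u : S) ∉ A := by
    intro h3
    rw [h1 u h3] at hku
    exact hl1 (mul_eq_right.1 hku.symm)
  set m := α t₀ with hm
  have hmV : (α⁻¹ m : S) ∈ A := by rwa [hm, MulAut.inv_apply_self]
  obtain ⟨γ, hγ, hγ1, hγ2⟩ := hT.exists_transvection hA hα hmV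
  have hinv : ∀ s t : T, (α⁻¹ s : S) ∈ A → ((α⁻¹ (s * t) : S) ∈ A ↔ (α⁻¹ t : S) ∈ A) := by
    intro s t hs
    rw [map_mul]
    exact A.mul_mem_cancel_left hs
  have hcongr : ∀ δ ε : MulAut T, γ * δ = ε * γ → MulAut.congr γ δ = ε := by
    intro δ ε h
    change γ * δ * γ⁻¹ = ε
    rw [h, mul_inv_cancel_right]
  -- Transvections with a common axis commute, so γ fixes k under conjugation.
  have hgD : g ∈ extDomain γ := by
    refine mem_extDomain hgN hg ?_
    rw [hcongr k k ?_]
    · exact hk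
    · ext1 t
      rw [MulAut.mul_apply, MulAut.mul_apply]
      by_cases h3 : (α⁻¹ t : S) ∈ A
      · rw [h1 t h3, hγ1 t h3, h1 t h3]
      · rw [h2 t h3, hγ2 t h3, h2 _ (by rwa [hinv _ _ hmV]), hγ2 _ (by rwa [hinv _ _ hl]),
          ← mul_assoc, ← mul_assoc, hT.mul_comm l m]
  -- Here γκγ⁻¹ = κk, again induced by S; the cases are the cosets of V and of T ∩ A.
  have hbD : b ∈ extDomain γ := by
    refine mem_extDomain hbN hκb ?_
    rw [hcongr κ (κ * k) ?_]
    · exact mul_mem hκ hk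
    · ext1 t
      rw [MulAut.mul_apply, MulAut.mul_apply, MulAut.mul_apply]
      by_cases h3 : (α⁻¹ t : S) ∈ A <;> by_cases h4 : (t : S) ∈ A
      · rw [hκ1 t h4, hγ1 t h3, h1 t h3, hκ1 t h4]
      · rw [hκ2 t h4, hγ1 t h3, h1 t h3, hκ2 t h4, hγ1 _ (by rwa [hinv _ _ hl])]
      · have h5 : ((l * (m * t) : T) : S) ∉ A := by
          change (l : S) * (m * t) ∉ A
          rwa [A.mul_mem_cancel_left hlA, A.mul_mem_cancel_right h4]
        rw [hκ1 t h4, hγ2 t h3, h2 _ (by rwa [hinv _ _ hmV]), hκ2 _ h5, hT.mul_mul_self]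
      · have h5 : ((l * (m * t) : T) : S) ∈ A :=
          A.mul_mem hlA (hT.mul_mem_of_notMem hA hαt₀ h4)
        rw [hκ2 t h4, hγ2 _ (by rwa [hinv _ _ hl]), hγ2 t h3, h2 _ (by rwa [hinv _ _ hmV]),
          hκ1 _ h5, ← mul_assoc, ← mul_assoc, hT.mul_comm l m]
  obtain ⟨g', h', h3⟩ := exists_commutator_eq hF hγ (hF.sylow T hTn).1 hgD hbD (t := u) rfl
  have h4 : (γ u : S) ∈ A := by
    rw [h3]
    exact hA.commutator_mem g' h'
  rw [hγ2 u huV] at h4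
  exact hαt₀ ((A.mul_mem_cancel_right huA).1 h4)

end QuarterTurn

end FusionSystem

namespace FusionSystem

/-! ### Isomorphisms of frames, fusion of involutions, strong closure -/

section Frames

variable {S : Type*} [Group S] {A T E : Subgroup S}

theorem QuarterTurn.relIndex_eq_two (hA : QuarterTurn A) (hT : ∀ t ∈ T, t * t = 1)
    (h : ¬ T ≤ A) : A.relIndex T = 2 := by
  obtain ⟨x, hx, hxA⟩ := SetLike.not_le_iff_exists.1 h
  refine Subgroup.index_eq_two_iff.2 ⟨⟨x, hx⟩, fun b => ?_⟩
  have hsq : ∀ t ∈ T, t * t ∈ A := fun t ht => by rw [hT t ht]; exact A.one_mem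
  simp only [Subgroup.mem_subgroupOf, Subgroup.coe_mul]
  by_cases hb : (b : S) ∈ A
  · exact Or.inr ⟨hb, fun h1 => hxA ((A.mul_mem_cancel_left hb).1 h1)⟩
  · exact Or.inl ⟨hA.mul_mem _ _ hb (hsq _ b.2) hxA (hsq _ hx), hb⟩

theorem card_eq_relIndex_mul (A T : Subgroup S) :
    Nat.card T = A.relIndex T * Nat.card (A ⊓ T : Subgroup S) := by
  rw [← Subgroup.index_mul_card (A.subgroupOf T), Subgroup.relIndex,
    ← Subgroup.inf_subgroupOf_right A T,
    Nat.card_congr (Subgroup.subgroupOfEquivOfLe (inf_le_right : A ⊓ T ≤ T)).toEquiv]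

/-- Counting: A ∩ T consists of elements squaring to 1, so it lies in A ∩ E, which has half the
order of T. Hence T is not in A, its part in A also has index two, and the two intersections
coincide. -/
theorem IsFrame.of_mulEquiv [Finite S] (hA : QuarterTurn A) (hE : IsFrame A E) (φ : E ≃* T) :
    IsFrame A T := by
  have hsq : ∀ t ∈ T, t * t = 1 := by
    intro t ht
    have h1 : (⟨t, ht⟩ : T) * ⟨t, ht⟩ = 1 := φ.symm.injective (by
      rw [map_mul, hE.mul_self, map_one])
    exact congrArg Subtype.val h1
  have hEA : ¬ E ≤ A := fun h => by
    obtain ⟨x, hx, hxA⟩ := hE.exists_notMem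
    exact hxA (h hx)
  have hcE := card_eq_relIndex_mul A E
  rw [hA.relIndex_eq_two hE.sq hEA] at hcE
  have hcT := card_eq_relIndex_mul A T
  rw [← Nat.card_congr φ.toEquiv] at hcT
  have hle : A ⊓ T ≤ A ⊓ E := fun t ht => ⟨ht.1, hE.mem t ht.1 (hsq t ht.2)⟩
  have hcard := Subgroup.card_le_of_le hle
  have hpos : 0 < Nat.card (A ⊓ E : Subgroup S) := Nat.card_pos
  have hTA : ¬ T ≤ A := fun h => by
    rw [Subgroup.relIndex_eq_one.2 h] at hcT
    omega
  rw [hA.relIndex_eq_two hsq hTA] at hcT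
  have heq : A ⊓ T = A ⊓ E := Subgroup.eq_of_le_of_card_ge hle (by omega)
  refine ⟨hsq, fun v hv hv2 => ?_, SetLike.not_le_iff_exists.1 hTA⟩
  have h1 : v ∈ A ⊓ E := ⟨hv, hE.mem v hv hv2⟩
  rw [← heq] at h1
  exact h1.2

theorem isPGroup_autS {p : ℕ} (hS : IsPGroup p S) (P : Subgroup S) : IsPGroup p (autS P) := by
  have h := hS.to_subgroup (Subgroup.normalizer (P : Set S))
  exact h.of_surjective _ P.normalizerMonoidHom.rangeRestrict_surjective

/-- The centralizer of `x` in `A⟨x⟩`, for an involution `x` inverting `A`. -/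
def frameOf (A : Subgroup S) (x : S) (hx : x * x = 1) : Subgroup S where
  carrier := {g | (g ∈ A ∨ g * x ∈ A) ∧ g * x = x * g}
  one_mem' := ⟨Or.inl A.one_mem, by simp⟩
  mul_mem' {g h} hg hh := by
    refine ⟨?_, by rw [mul_assoc, hh.2, ← mul_assoc, hg.2, mul_assoc]⟩
    rcases hg.1 with h1 | h1 <;> rcases hh.1 with h2 | h2
    · exact Or.inl (A.mul_mem h1 h2)
    · exact Or.inr (by rw [mul_assoc]; exact A.mul_mem h1 h2)
    · exact Or.inr (by rw [mul_assoc, hh.2, ← mul_assoc]; exact A.mul_mem h1 h2)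
    · refine Or.inl ?_
      have h3 : g * h = g * x * (h * x) := by
        calc g * h = g * (x * x) * h := by rw [hx, mul_one]
          _ = g * x * (x * h) := by group
          _ = _ := by rw [hh.2]
      rw [h3]
      exact A.mul_mem h1 h2
  inv_mem' {g} hg := by
    have h2 : g⁻¹ * x = x * g⁻¹ := (show Commute g x from hg.2).inv_left.eq
    refine ⟨hg.1.imp A.inv_mem fun h1 => ?_, h2⟩
    have h3 := A.inv_mem h1
    rwa [mul_inv_rev, inv_eq_of_mul_eq_one_left hx, ← h2] at h3

theorem isFrame_frameOf (hA : QuarterTurn A) {x : S} (hxA : x ∉ A) (hx : x * x = 1) :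
    IsFrame A (frameOf A x hx) := by
  have hinv := hA.conj_eq_inv x hxA (by rw [hx]; exact A.one_mem)
  have hfix : ∀ a ∈ A, a * x = x * a → a * a = 1 := fun a ha h => by
    have h1 := hinv a ha
    rw [← h, mul_inv_cancel_right] at h1
    rw [← mul_inv_cancel a, ← h1]
  refine ⟨fun g hg => ?_, fun v hv hv2 => ⟨Or.inl hv, ?_⟩, x, ⟨Or.inr ?_, rfl⟩, hxA⟩
  · obtain ⟨h1 | h1, h2⟩ := hg
    · exact hfix g h1 h2
    · rw [← hfix _ h1 (by rw [h2, mul_assoc, h2])]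
      calc g * g = g * (x * x) * g := by rw [hx, mul_one]
        _ = g * x * (x * g) := by group
        _ = _ := by rw [h2]
  · have h1 := hinv v hv
    rw [inv_eq_of_mul_eq_one_left hv2] at h1
    exact (mul_inv_eq_iff_eq_mul.1 h1).symm
  · rw [hx]
    exact A.one_mem

/-- Every g with g² in A centralizes or inverts A, so it fixes y. -/
theorem index_centralizer_le_two (hA : QuarterTurn A) {y : S} (hy : y ∈ A) (hy2 : y * y = 1) :
    (Subgroup.centralizer (Subgroup.zpowers y : Set S)).index ≤ 2 := by
  set C := Subgroup.centralizer (Subgroup.zpowers y : Set S) with hC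
  have hmem : ∀ g : S, g * y = y * g → g ∈ C := fun g hg => by
    rw [hC, Subgroup.mem_centralizer_iff]
    intro t ht
    obtain ⟨k, rfl⟩ := Subgroup.mem_zpowers_iff.1 ht
    exact (((show Commute g y from hg).zpow_right k).eq).symm
  have hsq : ∀ g : S, g * g ∈ A → g ∈ C := fun g hg => by
    apply hmem
    by_cases hgA : g ∈ A
    · exact hA.comm g hgA y hy
    · have h1 := hA.conj_eq_inv g hgA hg y hy
      rw [inv_eq_of_mul_eq_one_left hy2] at h1
      exact mul_inv_eq_iff_eq_mul.1 h1
  by_cases hCt : C = ⊤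
  · rw [hCt, Subgroup.index_top]
    norm_num
  · obtain ⟨a, ha⟩ : ∃ a, a ∉ C := by
      by_contra! h
      exact hCt ((Subgroup.eq_top_iff' C).2 h)
    refine le_of_eq (Subgroup.index_eq_two_iff.2 ⟨a, fun b => ?_⟩)
    by_cases hb : b ∈ C
    · exact Or.inr ⟨hb, fun h1 => ha ((C.mul_mem_cancel_left hb).1 h1)⟩
    · exact Or.inl ⟨hsq _ (hA.sq_mul_mem b a (fun h => hb (hsq b h)) fun h => ha (hsq a h)), hb⟩

theorem mem_of_centralizer_eq_top (hA : QuarterTurn A) {d : S} (hd : d * d = 1)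
    (h : ∀ g : S, d * g = g * d) : d ∈ A := by
  by_contra hdA
  obtain ⟨v, hv, -, -, hv2, -, hv1, -⟩ := hA.exists_pair
  obtain ⟨b, hb, hbv⟩ := hA.exists_sqrt v hv hv2
  have h1 := hA.conj_eq_inv d hdA (by rw [hd]; exact A.one_mem) b hb
  rw [h, mul_inv_cancel_right] at h1
  apply hv1
  rw [← hbv, ← mul_inv_cancel b, ← h1]

variable [Finite S] {F : FusionSystem S}

/-- Automorphisms of a fully normalized frame preserve its intersection with `A`. -/
theorem IsFrame.aut_apply_mem (hF : F.IsSaturated 2) (hA : QuarterTurn A) (hT : IsFrame A T)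
    (hTn : F.FullyNormalized T) {α : MulAut T} (hα : α ∈ F.aut T) {t : T} (ht : (t : S) ∈ A) :
    (α t : S) ∈ A := by
  by_contra hαt
  -- The index-two subgroup α(T ∩ A) contains one of a, b, ab.
  obtain ⟨l, hl1, hlA, hαl⟩ : ∃ l : T, l ≠ 1 ∧ (l : S) ∈ A ∧ (α⁻¹ l : S) ∈ A := by
    obtain ⟨a, ha, b, hb, ha2, hb2, ha1, hb1, hab⟩ := hA.exists_pair
    set a' : T := ⟨a, hT.mem a ha ha2⟩ with ha'
    set b' : T := ⟨b, hT.mem b hb hb2⟩ with hb'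
    by_cases h1 : (α⁻¹ a' : S) ∈ A
    · exact ⟨a', fun h => ha1 (congrArg Subtype.val h), ha, h1⟩
    by_cases h2 : (α⁻¹ b' : S) ∈ A
    · exact ⟨b', fun h => hb1 (congrArg Subtype.val h), hb, h2⟩
    refine ⟨a' * b', fun h => hab ?_, A.mul_mem ha hb, ?_⟩
    · rw [mul_eq_one_iff_eq_inv, hT.inv_eq] at h
      exact congrArg Subtype.val h
    · rw [map_mul]
      exact hT.mul_mem_of_notMem hA h1 h2
  obtain ⟨p, hp, hp1, hp2⟩ := hT.exists_transvection hA (F.aut T).one_mem (l := l) hlA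
  obtain ⟨q, hq, hq1, hq2⟩ := hT.exists_transvection hA hα hαl
  have hpl : p ∈ lineStabilizer l (hT.mul_self l) :=
    ⟨hp1 l hlA, fun t => (em _).imp (hp1 t) (hp2 t)⟩
  have hql : q ∈ lineStabilizer l (hT.mul_self l) :=
    ⟨hq1 l hαl, fun t => (em _).imp (hq1 t) (hq2 t)⟩
  -- Sharing the center l, p and q lie in one 2-group, so a single β conjugates both into Aut_S(T).
  obtain ⟨β, hβ, h⟩ := exists_conj_mem_autS hF hTn (isPGroup_lineStabilizer l (hT.mul_self l))
  have hl' : β l ≠ 1 := fun h1 => hl1 (β.injective (h1.trans (map_one β).symm))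
  have hconj : ∀ (k : MulAut T) (t : T), (β * k * β⁻¹) t = β (k (β⁻¹ t)) := fun k t => rfl
  have hfix : ∀ (k : MulAut T) (t : T), k (β⁻¹ t) = β⁻¹ t → (β * k * β⁻¹) t = t :=
    fun k t h1 => by rw [hconj, h1, MulAut.apply_inv_self]
  have hmove : ∀ (k : MulAut T) (t : T), k (β⁻¹ t) = l * β⁻¹ t →
      (β * k * β⁻¹) t = β l * t :=
    fun k t h1 => by rw [hconj, h1, map_mul, MulAut.apply_inv_self]
  -- One of the conjugated axes βα(T ∩ A) and β(T ∩ A) differs from T ∩ A.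
  by_cases hβA : ∀ t : T, (t : S) ∈ A → (β t : S) ∈ A
  · have hinv : ∀ t : T, (β * α)⁻¹ t = α⁻¹ (β⁻¹ t) := fun t => by
      rw [mul_inv_rev, MulAut.mul_apply]
    refine hT.not_mem_autS hF hA hTn (mul_mem hβ hα) ht
      (fun h1 => hαt (hT.mem_of_apply_mem hA hT hβA h1)) hl' ?_ (k := β * q * β⁻¹) ?_ ?_
      (h q hql hq)
    · rwa [hinv, MulAut.inv_apply_self]
    · intro t h1
      rw [hinv] at h1
      exact hfix _ _ (hq1 _ h1)
    · intro t h1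
      rw [hinv] at h1
      exact hmove _ _ (hq2 _ h1)
  · push Not at hβA
    obtain ⟨t₀, ht₀, hβt₀⟩ := hβA
    refine hT.not_mem_autS hF hA hTn hβ ht₀ hβt₀ hl' (by rwa [MulAut.inv_apply_self])
      (k := β * p * β⁻¹) ?_ ?_ (h p hpl hp)
    · exact fun t h1 => hfix _ _ (hp1 _ h1)
    · exact fun t h1 => hmove _ _ (hp2 _ h1)

/-- With t = b² and x in E inverting A, t = [b, x]. After composing φ with a suitable β, both b and
x lie in the extension domain, so t maps to a commutator of S; β itself preserves T ∩ A. -/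
theorem IsFrame.apply_mem_of_fullyNormalized (hS : IsPGroup 2 S) (hF : F.IsSaturated 2)
    (hA : QuarterTurn A) (hE : IsFrame A E) (hT : IsFrame A T) (hTn : F.FullyNormalized T)
    {φ : E ≃* T} (hφ : φ ∈ F.Iso E T) {t : E} (ht : (t : S) ∈ A) : (φ t : S) ∈ A := by
  obtain ⟨β, hβ, h⟩ := exists_conj_mem_autS hF hTn
    ((isPGroup_autS hS E).map (MulAut.congr φ).toMonoidHom)
  have hβφ : φ.trans β ∈ F.Iso E T := Iso.trans_mem hφ hβ
  have hTc := (hF.sylow T hTn).1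
  suffices h1 : (φ.trans β t : S) ∈ A from
    hT.mem_of_apply_mem hA hT (fun s hs => hT.aut_apply_mem hF hA hTn hβ hs) h1
  obtain ⟨b, hb, hbt⟩ := hA.exists_sqrt t ht (hE.sq t t.2)
  obtain ⟨hbN, κ, hκ, hκb, -, -⟩ := hE.exists_conj hA hb hbt
  have hbD : b ∈ extDomain (φ.trans β) := by
    refine mem_extDomain hbN hκb ?_
    exact h _ ⟨κ, hκ, rfl⟩ (congr_mem_aut hφ (F.autS_le_aut E hκ))
  obtain ⟨x, hx, hxA⟩ := hE.exists_notMem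
  have hxD := le_extDomain hF hβφ hTc hx
  have hbx : (t : S) = b * x * b⁻¹ * x⁻¹ := by
    have h3 := hA.conj_eq_inv x hxA (by rw [hE.sq x hx]; exact A.one_mem) b⁻¹ (A.inv_mem hb)
    rw [inv_inv] at h3
    rw [← hbt]
    calc b * b = b * (x * b⁻¹ * x⁻¹) := by rw [h3]
      _ = _ := by group
  obtain ⟨g', h', h4⟩ := exists_commutator_eq hF hβφ hTc hbD hxD hbx
  rw [h4]
  exact hA.commutator_mem g' h'

theorem IsFrame.apply_mem (hS : IsPGroup 2 S) (hF : F.IsSaturated 2)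
    (hA : QuarterTurn A) (hE : IsFrame A E) {φ : E ≃* T} (hφ : φ ∈ F.Iso E T) {t : E}
    (ht : (t : S) ∈ A) : (φ t : S) ∈ A := by
  obtain ⟨N, hN, χ, hχ⟩ := F.exists_fullyNormalized T
  have hT := hE.of_mulEquiv hA φ
  have hNf := hT.of_mulEquiv hA χ
  exact hT.mem_of_apply_mem hA hNf
    (fun s hs => hT.apply_mem_of_fullyNormalized hS hF hA hNf hN hχ hs)
    (hE.apply_mem_of_fullyNormalized hS hF hA hNf hN (Iso.trans_mem hφ hχ) ht)

/-- The frame of x centralizes X, so θ extends to it, and isomorphisms of frames preserve membership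
in A both ways. -/
theorem apply_notMem_of_fullyCentralized (hS : IsPGroup 2 S) (hF : F.IsSaturated 2)
    (hA : QuarterTurn A) {X D : Subgroup S} {x : X} (hX : X ≤ Subgroup.zpowers (x : S))
    (hxA : (x : S) ∉ A) (hx : (x : S) * x = 1) {θ : X ≃* D} (hθ : θ ∈ F.Iso X D)
    (hD : F.FullyCentralized D) : (θ x : S) ∉ A := by
  intro hθx
  have hE := isFrame_frameOf hA hxA hx
  have hle : frameOf A x hx ≤ extDomain θ := by
    rintro g ⟨-, hg⟩
    have hfix : ∀ t ∈ X, g * t * g⁻¹ = t := fun t ht => by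
      obtain ⟨k, rfl⟩ := Subgroup.mem_zpowers_iff.1 (hX ht)
      rw [((show Commute g x from hg).zpow_right k).eq, mul_inv_cancel_right]
    refine mem_extDomain (γ := 1) ?_ (fun t => (hfix t t.2).symm) ?_
    · rw [Subgroup.mem_normalizer_iff]
      refine fun t => ⟨fun ht => by rwa [hfix t ht], fun ht => ?_⟩
      have h1 : g * t * g⁻¹ = t := by
        have h2 := hfix _ ht
        have h3 : g * t * g⁻¹ = g⁻¹ * (g * (g * t * g⁻¹) * g⁻¹) * g := by group
        rw [h3, h2]
        group
      rwa [h1] at ht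
    · rw [map_one]
      exact one_mem _
  obtain ⟨ψ, hψ, h1, -, h2⟩ := hF.extension X D θ hθ hD
  obtain ⟨E', -, e, he, h3⟩ := exists_iso_restrict hψ hle
  have hE' := hE.of_mulEquiv hA e
  have hxE : (x : S) ∈ frameOf A x hx := ⟨Or.inr (by rw [hx]; exact A.one_mem), rfl⟩
  have h4 : (e ⟨x, hxE⟩ : S) ∈ A := by
    rw [h3]
    exact (h2 x).symm ▸ hθx
  have h5 := hE'.apply_mem hS hF hA (Iso.symm_mem he) h4
  rw [MulEquiv.symm_apply_apply] at h5
  exact hxA h5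

/-- An involution outside `A` is not conjugate to an involution of `A`. -/
theorem apply_mem_of_involution (hS : IsPGroup 2 S) (hF : F.IsSaturated 2)
    (hA : QuarterTurn A) {X : Subgroup S} {y : S} (hy : y ∈ A) (hy2 : y * y = 1)
    {φ : Subgroup.zpowers y ≃* X} (hφ : φ ∈ F.Iso (Subgroup.zpowers y) X) :
    (φ ⟨y, Subgroup.mem_zpowers y⟩ : S) ∈ A := by
  by_contra hxA
  set x : X := φ ⟨y, Subgroup.mem_zpowers y⟩ with hx
  have hxx : x * x = 1 := by
    rw [hx, ← map_mul]
    exact (congrArg φ (Subtype.ext hy2)).trans (map_one φ)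
  have hX : X ≤ Subgroup.zpowers (x : S) := by
    intro t ht
    obtain ⟨⟨s, hs⟩, hst⟩ := φ.surjective ⟨t, ht⟩
    obtain ⟨k, rfl⟩ := Subgroup.mem_zpowers_iff.1 hs
    refine Subgroup.mem_zpowers_iff.2 ⟨k, ?_⟩
    have h1 : x ^ k = ⟨t, ht⟩ := by
      rw [← hst, hx, ← map_zpow]
      rfl
    exact congrArg Subtype.val h1
  have hxx' : (x : S) * x = 1 := congrArg Subtype.val hxx
  obtain ⟨D, hD, χ, hχ⟩ := F.exists_fullyCentralized X
  -- If D is central, it lies in A, which is impossible for the image of x. Otherwise its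
  -- centralizer has index at least 2, so ⟨y⟩ is already fully centralized and φ⁻¹ gives the
  -- contradiction.
  by_cases hDt : Subgroup.centralizer (D : Set S) = ⊤
  · refine apply_notMem_of_fullyCentralized hS hF hA hX hxA hxx' hχ hD
      (mem_of_centralizer_eq_top hA ?_ fun g => ?_)
    · have h1 : χ x * χ x = 1 := by rw [← map_mul, hxx, map_one]
      exact congrArg Subtype.val h1
    · have h1 : g ∈ Subgroup.centralizer (D : Set S) := hDt ▸ Subgroup.mem_top g
      exact Subgroup.mem_centralizer_iff.1 h1 _ (χ x).2
  · have hyc : F.FullyCentralized (Subgroup.zpowers y) := by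
      rintro Q ⟨f, hf⟩
      have h1 := hD Q ⟨_, Iso.trans_mem (Iso.symm_mem hχ) (Iso.trans_mem (Iso.symm_mem hφ) hf)⟩
      have h2 := Subgroup.one_lt_index_of_ne_top hDt
      have h3 := index_centralizer_le_two hA hy hy2
      have h4 := Subgroup.index_mul_card (Subgroup.centralizer (D : Set S))
      have h5 := Subgroup.index_mul_card
        (Subgroup.centralizer (Subgroup.zpowers y : Set S))
      have h6 := Nat.mul_le_mul_right (Nat.card (Subgroup.centralizer (D : Set S))) h2
      have h7 := Nat.mul_le_mul_right
        (Nat.card (Subgroup.centralizer (Subgroup.zpowers y : Set S))) h3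
      omega
    refine apply_notMem_of_fullyCentralized hS hF hA hX hxA hxx' (Iso.symm_mem hφ) hyc ?_
    rw [hx, MulEquiv.symm_apply_apply]
    exact hy

theorem QuarterTurn.stronglyClosed (hS : IsPGroup 2 S) (hF : F.IsSaturated 2)
    (hA : QuarterTurn A) : F.StronglyClosed A := by
  have key : ∀ (P Q : Subgroup S) (φ : P →* Q), φ ∈ F.Hom P Q → ∀ x : P, (x : S) ∈ A →
      (φ x : S) * φ x ∈ A → (φ x : S) ∈ A := by
    intro P Q φ hφ x hx hxx
    by_contra h
    have h1 : φ x * φ x = 1 := Subtype.ext (hA.sq_eq_one _ h hxx)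
    rw [← map_mul] at h1
    have h2 : x * x = 1 := F.injective hφ (h1.trans (map_one φ).symm)
    have hle : Subgroup.zpowers (x : S) ≤ P := by
      rw [Subgroup.zpowers_le]
      exact x.2
    obtain ⟨R, -, e, he, h3⟩ := exists_iso_restrict hφ hle
    have h4 := apply_mem_of_involution hS hF hA hx (congrArg Subtype.val h2) he
    rw [h3] at h4
    exact h h4
  intro P Q φ hφ x hx
  by_contra h
  -- Apply `key` to x²: the square of its image is a fourth power, hence in A, so φ(x)² lies in A
  -- after all.
  have h1 : (φ x : S) * φ x ∉ A := fun h1 => h (key P Q φ hφ x hx h1)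
  have h2 := key P Q φ hφ (x * x) (A.mul_mem hx hx)
  rw [map_mul] at h2
  exact h1 (h2 (hA.fourth_mem _))

end Frames

end FusionSystem

/-! ### Verifying the quarter-turn properties for the given group -/

section Construction

theorem ZMod.exists_add_self_eq {n : ℕ} (hn : 2 ≤ n) {z : ZMod (2 ^ n)} (hz : z + z = 0) :
    ∃ w, w + w = z := by
  obtain ⟨m, rfl⟩ := Nat.exists_eq_add_of_le' hn
  have h1 : ((z.val + z.val : ℕ) : ZMod (2 ^ (m + 2))) = 0 := by
    rw [Nat.cast_add, ZMod.natCast_zmod_val, hz]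
  rw [ZMod.natCast_eq_zero_iff] at h1
  obtain ⟨k, hk⟩ := h1
  -- From 2z = 2^(m+2)·k over the naturals, z = 2^(m+1)·k, whose half is 2^m·k.
  refine ⟨((2 ^ m * k : ℕ) : ZMod (2 ^ (m + 2))), ?_⟩
  rw [← Nat.cast_add, ← ZMod.natCast_zmod_val z]
  congr 1
  have h2 : 2 ^ (m + 2) * k = 4 * (2 ^ m * k) := by ring
  lia

theorem ZMod.exists_ne_zero_add_self {n : ℕ} (hn : 2 ≤ n) :
    ∃ z : ZMod (2 ^ n), z ≠ 0 ∧ z + z = 0 := by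
  obtain ⟨m, rfl⟩ := Nat.exists_eq_add_of_le' hn
  refine ⟨((2 ^ (m + 1) : ℕ) : ZMod (2 ^ (m + 2))), ?_, ?_⟩
  · rw [Ne, ZMod.natCast_eq_zero_iff]
    exact Nat.not_dvd_of_pos_of_lt (by positivity) (Nat.pow_lt_pow_right (by norm_num) (by lia))
  · rw [← Nat.cast_add, ZMod.natCast_eq_zero_iff, pow_succ 2 (m + 1), mul_two]

theorem quarterTurn_of_isComplement' (n : ℕ) (hn : 2 ≤ n) {S : Type*} [Group S] (v w σ : S)
    (A : Subgroup S) (hcard : Nat.card S = 2 ^ (2 * n + 2)) (hA : A = Subgroup.closure {v, w})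
    (hAiso : Nonempty (A ≃* Multiplicative (ZMod (2 ^ n)) × Multiplicative (ZMod (2 ^ n))))
    (hAnormal : A.Normal) (hcompl : Subgroup.IsComplement' A (Subgroup.zpowers σ))
    (hσ : σ ^ 4 = 1) (hv : σ⁻¹ * v * σ = w) (hw : σ⁻¹ * w * σ = v⁻¹) :
    FusionSystem.QuarterTurn A := by
  obtain ⟨e⟩ := hAiso
  have hcomm : ∀ a ∈ A, ∀ b ∈ A, a * b = b * a := fun a ha b hb => by
    have h1 : (⟨a, ha⟩ : A) * ⟨b, hb⟩ = ⟨b, hb⟩ * ⟨a, ha⟩ :=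
      e.injective (by rw [map_mul, map_mul, mul_comm])
    exact congrArg Subtype.val h1
  have hinv : ∀ a ∈ A, (σ * σ)⁻¹ * a * (σ * σ) = a⁻¹ := by
    intro a ha
    rw [hA] at ha
    induction ha using Subgroup.closure_induction with
    | mem x hx =>
      have h1 : ∀ y, (σ * σ)⁻¹ * y * (σ * σ) = σ⁻¹ * (σ⁻¹ * y * σ) * σ := fun y => by group
      rcases hx with rfl | rfl
      · rw [h1, hv, hw]
      · rw [h1, hw, ← hv]
        group
    | one => group
    | mul x y hx hy h1 h2 =>
      rw [← hA] at hx hy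
      have h3 : (x * y)⁻¹ = x⁻¹ * y⁻¹ := by rw [hcomm x hx y hy, mul_inv_rev]
      rw [h3, ← h1, ← h2]
      group
    | inv x hx h1 =>
      have h2 : (σ * σ)⁻¹ * x⁻¹ * (σ * σ) = ((σ * σ)⁻¹ * x * (σ * σ))⁻¹ := by
        simp [mul_assoc]
      rw [h2, h1]
  have hσσ : σ * σ * (σ * σ) = 1 := by rw [← hσ, ← pow_two σ, ← pow_add]
  have hcardA : Nat.card A = 2 ^ n * 2 ^ n := by
    rw [Nat.card_congr e.toEquiv, Nat.card_prod]
    simp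
  have hcardσ : Nat.card (Subgroup.zpowers σ) = 4 := by
    have h1 := hcompl.card_mul_card
    rw [hcardA, hcard] at h1
    have h2 : 2 ^ (2 * n + 2) = 2 ^ n * 2 ^ n * 4 := by ring
    rw [h2] at h1
    exact Nat.eq_of_mul_eq_mul_left (by positivity) h1
  have hcardQ : Nat.card (S ⧸ A) = 4 := by
    have h1 := Subgroup.index_mul_card A
    rw [← hcompl.card_mul_card, mul_comm] at h1
    rw [← hcardσ]
    exact Nat.eq_of_mul_eq_mul_left (hcardA ▸ by positivity : 0 < Nat.card A) h1
  have hcyc : IsCyclic (S ⧸ A) := by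
    refine ⟨⟨(σ : S ⧸ A), fun x => ?_⟩⟩
    obtain ⟨s, rfl⟩ := QuotientGroup.mk_surjective x
    obtain ⟨⟨⟨a, ha⟩, ⟨t, ht⟩⟩, hat⟩ := hcompl.surjective s
    obtain ⟨k, rfl⟩ := Subgroup.mem_zpowers_iff.1 ht
    have hat : a * σ ^ k = s := hat
    refine Subgroup.mem_zpowers_iff.2 ⟨k, ?_⟩
    rw [← hat, QuotientGroup.mk_mul, (QuotientGroup.eq_one_iff a).2 ha, one_mul,
      QuotientGroup.mk_zpow]
  have f := zmodCyclicMulEquiv hcyc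
  rw [hcardQ] at f
  -- Reading S/A as ℤ/4 turns membership in A into finite checks.
  set q : S → ZMod 4 := fun s => Multiplicative.toAdd (f.symm s) with hq
  have hqmul : ∀ g h, q (g * h) = q g + q h := fun g h => by
    rw [hq]
    simp
  have hqA : ∀ g, g ∈ A ↔ q g = 0 := fun g => by
    rw [hq]
    simp
  have hσA : σ * σ ∉ A := by
    intro h1
    have h2 : σ * σ ∈ A ⊓ Subgroup.zpowers σ :=
      ⟨h1, mul_mem (Subgroup.mem_zpowers σ) (Subgroup.mem_zpowers σ)⟩
    rw [hcompl.disjoint.eq_bot, Subgroup.mem_bot, ← pow_two] at h2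
    have h3 := orderOf_dvd_of_pow_eq_one h2
    rw [← Nat.card_zpowers, hcardσ] at h3
    norm_num at h3
  -- Both g and σ² map to 2, the only element of order two in ℤ/4.
  have hcoset : ∀ g, g ∉ A → g * g ∈ A → g * (σ * σ) ∈ A := by
    intro g h1 h2
    rw [hqA, hqmul] at *
    rw [hqmul]
    revert h1 h2 hσA
    generalize q g = x
    generalize q σ = y
    revert x y
    decide
  have hinv' : ∀ g, g ∉ A → g * g ∈ A → ∀ a ∈ A, g * a * g⁻¹ = a⁻¹ := by
    intro g h1 h2 a ha
    have h3 := hcoset g h1 h2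
    have h4 := hinv a ha
    calc g * a * g⁻¹ = (g * (σ * σ)) * ((σ * σ)⁻¹ * a * (σ * σ)) * (g * (σ * σ))⁻¹ := by group
      _ = a⁻¹ := by rw [h4, hcomm _ h3 _ (A.inv_mem ha), mul_inv_cancel_right]
  refine ⟨hAnormal, hcomm, ?_, ?_, ?_, hinv', ?_, ?_, ?_, ?_⟩
  · intro g h
    have h1 : g * h = g * h * g⁻¹ * h⁻¹ * (h * g) := by group
    have h2 := congrArg q h1
    rw [hqmul, hqmul, hqmul h g, add_comm (q h)] at h2
    rw [hqA]
    exact right_eq_add.1 h2 |>.trans rfl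
  · intro g
    rw [hqA, hqmul, hqmul]
    generalize q g = x
    revert x
    decide
  · intro g h1 h2
    have h3 := hcoset g h1 h2
    -- g inverts gσ², an element of A; since σ⁴ = 1, this cancels to g² = 1.
    have h4 := hinv' g h1 h2 _ h3
    have h5 : g * (g * (σ * σ)) * g⁻¹ = (g * g) * ((σ * σ) * g⁻¹) := by group
    rw [h5, mul_inv_rev, inv_eq_of_mul_eq_one_left hσσ] at h4
    exact mul_eq_right.1 h4
  · intro g h h1 h2 h3 h4
    rw [hqA, hqmul] at *
    revert h1 h2 h3 h4
    generalize q g = x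
    generalize q h = y
    revert x y
    decide
  · intro g h
    simp only [hqA, hqmul]
    generalize q g = x
    generalize q h = y
    revert x y
    decide
  · intro a ha ha2
    have h1 : e ⟨a, ha⟩ * e ⟨a, ha⟩ = 1 := by
      rw [← map_mul]
      exact (congrArg e (Subtype.ext ha2)).trans (map_one e)
    obtain ⟨r, hr⟩ := ZMod.exists_add_self_eq hn (congrArg Prod.fst h1)
    obtain ⟨s, hs⟩ := ZMod.exists_add_self_eq hn (congrArg Prod.snd h1)
    have h2 : e.symm (.ofAdd r, .ofAdd s) * e.symm (.ofAdd r, .ofAdd s) = ⟨a, ha⟩ := by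
      rw [← map_mul, MulEquiv.symm_apply_eq]
      exact Prod.ext hr hs
    exact ⟨_, (e.symm (.ofAdd r, .ofAdd s)).2, congrArg Subtype.val h2⟩
  · obtain ⟨z, hz, hzz⟩ := ZMod.exists_ne_zero_add_self hn
    have hsq : ∀ x, x * x = 1 → (e.symm x : S) * e.symm x = 1 := fun x hx => by
      rw [← Subgroup.coe_mul, ← map_mul, hx, map_one, Subgroup.coe_one]
    have hne : ∀ x y, x ≠ y → (e.symm x : S) ≠ e.symm y := fun x y h h1 =>
      h (e.symm.injective (Subtype.ext h1))
    have hz' : Multiplicative.ofAdd z ≠ 1 := hz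
    have hone : (e.symm 1 : S) = 1 := by rw [map_one, Subgroup.coe_one]
    refine ⟨_, (e.symm (.ofAdd z, 1)).2, _, (e.symm (1, .ofAdd z)).2, hsq _ ?_, hsq _ ?_, ?_, ?_,
      hne _ _ ?_⟩
    · exact Prod.ext hzz (one_mul 1)
    · exact Prod.ext (one_mul 1) hzz
    · rw [← hone]
      exact hne _ _ fun h => hz' (congrArg Prod.fst h)
    · rw [← hone]
      exact hne _ _ fun h => hz' (congrArg Prod.snd h)
    · exact fun h => hz' (congrArg Prod.fst h)

end Construction

theorem lemma4p1 (n : ℕ) (hn : 2 ≤ n) {S : Type*} [Group S] (v w σ : S) (A : Subgroup S)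
    (hgen : Subgroup.closure {v, w, σ} = ⊤)
    (hcard : Nat.card S = 2 ^ (2 * n + 2))
    (hA : A = Subgroup.closure {v, w})
    (hAiso : Nonempty (A ≃* Multiplicative (ZMod (2 ^ n)) × Multiplicative (ZMod (2 ^ n))))
    (hAnormal : A.Normal)
    (hcompl : Subgroup.IsComplement' A (Subgroup.zpowers σ))
    (hσ : σ ^ 4 = 1)
    (hv : σ⁻¹ * v * σ = w)
    (hw : σ⁻¹ * w * σ = v⁻¹)
    (F : FusionSystem S) (hF : F.IsSaturated 2) :
    F.IsNormal A := by
  have hS : IsPGroup 2 S := IsPGroup.of_card hcard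
  have : Finite S := Nat.finite_of_card_ne_zero (by rw [hcard]; positivity)
  have hQ := quarterTurn_of_isComplement' n hn v w σ A hcard hA hAiso hAnormal hcompl hσ hv hw
  exact FusionSystem.isNormal_of_stronglyClosed hS hF hQ.comm (hQ.stronglyClosed hS hF)
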